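/- Let $S$ be a topological space. An open set $R\subseteq S$ is regular if $R=\mathrm{int}(\mathrm{clos}(R))$; the regular open sets form a Boolean algebra $\mathfrak R(S)$ under $\cap$, $Q\vee R=\mathrm{int}(\mathrm{clos}(Q\cup R))$ and $\neg R=\mathrm{int}(S\setminus R)$. A regular partition of $R\in\mathfrak R(S)$ is a finite family of pairwise disjoint $R_1,\dots,R_N\in\mathfrak R(S)$ with $R_1\vee\cdots\vee R_N=R$. A credence is a map $\mu:\mathfrak R(S)\to[0,1]$ with $\mu[S]=1$ and $\mu[\bigvee_n R_n]=\sum_n\mu[R_n]$ for every finite family of pairwise disjoint $R_n\in\mathfrak R(S)$. For $R\in\mathfrak R(S)$ let $\mathcal G(R)$ be the space of restrictions to $R$ of bounded continuous real functions on $S$, with the uniform norm over $R$. An integrator is a family $\mathbf I=\{I_R\}_{R\in\mathfrak R(S)}$ of bounded linear functionals $I_R:\mathcal G(R)\to\mathbb R$ that are weakly monotonic ($f\le g$ on $R$ implies $I_R[f]\le I_R[g]$) and satisfy $I_R[g]=\sum_n I_{R_n}[g|_{R_n}]$ for every regular partition $\{R_n\}$ of $R$ and every $g\in\mathcal G(R)$.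 It is compatible with $\mu$ if $\|I_R\|=\mu[R]$ for all $R$. Write $I_R[f]$ for $I_R[f|_R]$ whenever $f|_R\in\mathcal G(R)$. Let $C_0(S)$ be the set of continuous real functions on $S$ vanishing at infinity, and $\mathfrak R_0(S)$ the set of regular open sets with compact closure. A Borel measure is Radon (respectively normal) if the measure of every Borel set $B$ is the supremum of the measures of the compact (respectively closed) subsets of $B$ and also the infimum of the measures of the open supersets of $B$. A Borel measure $\nu$ represents $I_S$ on a set $F$ of continuous functions if every $f\in F$ is $\nu$-integrable with $I_S[f]=\int_S f\,d\nu$. A liminal density structure subordinate to $\nu$ is a family of classes $\phi_R\in L^1(\partial R,\nu;[0,1])$, $R\in\mathfrak R(S)$, such that $\phi_{R_1}+\cdots+\phi_{R_N}=1$ $\nu$-a.e. on $\partial R_1\cup\cdots\cup\partial R_N$ for every regular partition $\{R_1,\dots,R_N\}$ of $S$, where $\phi_{R_n}$ is read as $0$ outside $\partial R_n$. Consider the equations $$(1)\quad \mu[R]=\nu(R)+\int_{\partial R}\phi_R\,d\nu,\qquad (2)\quad I_R[f]=\int_R f\,d\nu+\int_{\partial R} f\,\phi_R\,d\nu .$$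 Theorem. Let $S$ be a locally compact $T_4$ (normal Hausdorff) space and $\mu$ a credence on $\mathfrak R(S)$. There is exactly one integrator $\mathbf I$ compatible with $\mu$, and the following holds for it. (a) There is a unique Radon measure $\nu$ on $S$ that represents $I_S$ on $C_0(S)$. For this $\nu$ there is a unique liminal density structure $\{\phi_R\}$ subordinate to $\nu$ such that (1) holds for all $R\in\mathfrak R_0(S)$ and (2) holds for all $f\in C_0(S)$ and all $R\in\mathfrak R(S)$. Moreover, for this structure, (2) holds for all continuous $f:S\to\mathbb R$ and all $R\in\mathfrak R_0(S)$ (in particular $f|_R\in\mathcal G(R)$). (b) If $S$ is a compact Hausdorff space, then there is a unique normal Borel probability measure $\nu$ on $S$ that represents $I_S$ on $C(S,\mathbb R)$, and for this $\nu$ there is a unique liminal density structure $\{\phi_R\}$ subordinate to $\nu$ such that (1) and (2) hold for all $R\in\mathfrak R(S)$ and all continuous $f:S\to\mathbb R$. (In all these formulas the right-hand sides are finite and the integrands integrable.) -/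

import Mathlib

open Set Filter Topology MeasureTheory
open scoped BoundedContinuousFunction

noncomputable section

/-! ### The Boolean algebra of regular open sets -/

/-- The Boolean algebra of regular open subsets of `S`, as the regular elements of the Heyting
algebra of open sets. The lemmas below spell out its elements and its operations. -/
abbrev RegOpen (S : Type*) [TopologicalSpace S] : Type _ :=
  Heyting.Regular (TopologicalSpace.Opens S)

namespace RegOpen

variable {S : Type*} [TopologicalSpace S]

/-- The underlying set of a regular open set. -/
def set (R : RegOpen S) : Set S := ((R : TopologicalSpace.Opens S) : Set S)

theorem opens_coe_compl (U : TopologicalSpace.Opens S) :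
    ((Uᶜ : TopologicalSpace.Opens S) : Set S) = interior ((U : Set S)ᶜ) := by
  ext x
  constructor
  · intro hx
    refine mem_interior.2 ⟨_, ?_, (Uᶜ : TopologicalSpace.Opens S).isOpen, hx⟩
    intro y hy hyU
    have h : y ∈ ((U ⊓ Uᶜ : TopologicalSpace.Opens S) : Set S) := ⟨hyU, hy⟩
    rw [inf_compl_self] at h
    exact h
  · intro hx
    let V : TopologicalSpace.Opens S := ⟨interior ((U : Set S)ᶜ), isOpen_interior⟩
    have hV : V ≤ Uᶜ := by
      rw [le_compl_iff_disjoint_right, disjoint_iff_inf_le]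
      rintro y ⟨hy1, hy2⟩
      exact (interior_subset hy1 : y ∈ (U : Set S)ᶜ) hy2
    exact hV hx

theorem opens_coe_compl_compl (U : TopologicalSpace.Opens S) :
    ((Uᶜᶜ : TopologicalSpace.Opens S) : Set S) = interior (closure (U : Set S)) := by
  rw [opens_coe_compl, opens_coe_compl, ← closure_compl, compl_compl]

theorem isOpen_set (R : RegOpen S) : IsOpen R.set := TopologicalSpace.Opens.isOpen _

theorem set_injective : Function.Injective (set : RegOpen S → Set S) := fun _ _ h =>
  Heyting.Regular.coe_injective (TopologicalSpace.Opens.ext h)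

/-- The elements of `RegOpen S` are exactly the sets `A` with `A = int (clos A)`. -/
theorem exists_set_eq_iff (A : Set S) :
    (∃ R : RegOpen S, R.set = A) ↔ interior (closure A) = A := by
  constructor
  · rintro ⟨R, rfl⟩
    have h : (R : TopologicalSpace.Opens S)ᶜᶜ = R := R.prop
    exact (opens_coe_compl_compl _).symm.trans (congrArg _ h)
  · intro h
    let U : TopologicalSpace.Opens S := ⟨A, h ▸ isOpen_interior⟩
    exact ⟨Heyting.Regular.toRegular U, (opens_coe_compl_compl U).trans h⟩

theorem set_top : (⊤ : RegOpen S).set = univ := rfl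

theorem set_bot : (⊥ : RegOpen S).set = ∅ := rfl

theorem set_inf (Q R : RegOpen S) : (Q ⊓ R).set = Q.set ∩ R.set := rfl

theorem set_sup (Q R : RegOpen S) : (Q ⊔ R).set = interior (closure (Q.set ∪ R.set)) :=
  opens_coe_compl_compl _

theorem set_compl (R : RegOpen S) : (Rᶜ).set = interior (R.setᶜ) :=
  opens_coe_compl _

theorem disjoint_iff_set (Q R : RegOpen S) : Disjoint Q R ↔ Disjoint Q.set R.set := by
  rw [disjoint_iff, Set.disjoint_iff_inter_eq_empty, ← set_inf, ← set_bot]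
  exact set_injective.eq_iff.symm

/-- `P` is a regular partition of `R`: its members are pairwise disjoint regular open sets whose
join in the Boolean algebra of regular open sets is `R`. -/
def IsPartition (R : RegOpen S) {N : ℕ} (P : Fin N → RegOpen S) : Prop :=
  Pairwise (Function.onFun Disjoint P) ∧ Finset.univ.sup P = R

/-- The regular open sets with compact closure. -/
def compactClosure (S : Type*) [TopologicalSpace S] : Set (RegOpen S) :=
  {R | IsCompact (closure R.set)}

end RegOpen

/-! ### Credences -/

/-- A credence: a finitely additive probability measure on the Boolean algebra of regular open
sets (additive for the join of that algebra, not for the union of sets). -/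
structure Credence (S : Type*) [TopologicalSpace S] where
  toFun : RegOpen S → ℝ
  mem_Icc : ∀ R, toFun R ∈ Icc (0 : ℝ) 1
  map_top : toFun ⊤ = 1
  additive : ∀ (N : ℕ) (P : Fin N → RegOpen S), Pairwise (Function.onFun Disjoint P) →
    toFun (Finset.univ.sup P) = ∑ n, toFun (P n)

/-! ### Integrators -/

/-- The restrictions to `R` of the bounded continuous real functions on `S`, a subspace of the
bounded continuous functions on `R` with the uniform norm over `R`. -/
def restrictedBCF {S : Type*} [TopologicalSpace S] (R : RegOpen S) :
    Submodule ℝ (R.set →ᵇ ℝ) where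
  carrier := {h | ∃ g : S →ᵇ ℝ, g.domRestrict R.set = h}
  add_mem' := by
    rintro _ _ ⟨g, rfl⟩ ⟨g', rfl⟩
    exact ⟨g + g', rfl⟩
  zero_mem' := ⟨0, rfl⟩
  smul_mem' := by
    rintro c _ ⟨g, rfl⟩
    exact ⟨c • g, rfl⟩

/-- The restriction of `g` to `R`. -/
def restrictBCF {S : Type*} [TopologicalSpace S] (R : RegOpen S) (g : S →ᵇ ℝ) :
    restrictedBCF R :=
  ⟨g.domRestrict R.set, g, rfl⟩

/-- An integrator: a family of bounded, weakly monotonic linear functionals, one on each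
`restrictedBCF R`, that is additive over regular partitions. -/
structure Integrator (S : Type*) [TopologicalSpace S] where
  toFun : ∀ R : RegOpen S, restrictedBCF R →ₗ[ℝ] ℝ
  bounded : ∀ R : RegOpen S, ∃ C : ℝ, ∀ f : restrictedBCF R, |toFun R f| ≤ C * ‖f.1‖
  monotone : ∀ (R : RegOpen S) (f g : restrictedBCF R),
    (∀ x : R.set, f.1 x ≤ g.1 x) → toFun R f ≤ toFun R g
  additive : ∀ (R : RegOpen S) (N : ℕ) (P : Fin N → RegOpen S), R.IsPartition P →
    ∀ g : S →ᵇ ℝ, toFun R (restrictBCF R g) = ∑ n, toFun (P n) (restrictBCF (P n) g)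

/-- `I` is compatible with `μ`: the operator norm of `I_R` (the supremum of `|I_R[f]|` over the
unit ball of `restrictedBCF R`) is `μ[R]`, for every `R`. -/
def Integrator.IsCompatible {S : Type*} [TopologicalSpace S] (I : Integrator S)
    (μ : Credence S) : Prop :=
  ∀ R : RegOpen S,
    IsLUB ((fun f : restrictedBCF R => |I.toFun R f|) '' {f | ‖f.1‖ ≤ 1}) (μ.toFun R)

/-- `I_R[f] = v`: the restriction of `f` to `R` lies in the domain of `I_R` and is mapped
to `v`. -/
def Integrator.HasValue {S : Type*} [TopologicalSpace S] (I : Integrator S) (R : RegOpen S)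
    (f : S → ℝ) (v : ℝ) : Prop :=
  ∃ g : restrictedBCF R, (∀ x : R.set, g.1 x = f x) ∧ I.toFun R g = v

/-- The continuous real functions on `S` that vanish at infinity. -/
def vanishingAtInfinity (S : Type*) [TopologicalSpace S] : Set C(S, ℝ) :=
  {f | Tendsto f (cocompact S) (𝓝 0)}

/-- The Riesz representation property of `ν` for `I_S` on a set `F` of continuous functions. -/
def Integrator.RieszProperty {S : Type*} [TopologicalSpace S] [MeasurableSpace S]
    (I : Integrator S) (ν : Measure S) (F : Set C(S, ℝ)) : Prop :=
  ∀ f ∈ F, Integrable f ν ∧ I.HasValue ⊤ f (∫ x, f x ∂ν)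

/-! ### Regularity of Borel measures -/

/-- Radon measures: every Borel set is inner regular for compact sets and outer regular for
open sets. -/
def IsRadonMeasure {S : Type*} [TopologicalSpace S] [MeasurableSpace S] (ν : Measure S) : Prop :=
  ν.InnerRegularWRT IsCompact MeasurableSet ∧ ν.OuterRegular

/-- Normal measures: every Borel set is inner regular for closed sets and outer regular for
open sets. -/
def IsNormalMeasure {S : Type*} [TopologicalSpace S] [MeasurableSpace S] (ν : Measure S) : Prop :=
  ν.InnerRegularWRT IsClosed MeasurableSet ∧ ν.OuterRegular

/-! ### Liminal density structures -/

/-- A family of classes `φ_R ∈ L¹(∂R, ν)`, one for each regular open set `R`. -/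
abbrev BoundaryDensity {S : Type*} [TopologicalSpace S] [MeasurableSpace S] (ν : Measure S) :
    Type _ :=
  ∀ R : RegOpen S, Lp ℝ 1 (ν.restrict (frontier R.set))

/-- `φ` is a liminal density structure subordinate to `ν`. In the sum over a partition, `φ_{R_n}`
is extended by `0` outside of its domain `∂R_n`. -/
structure IsLiminalDensity {S : Type*} [TopologicalSpace S] [MeasurableSpace S] {ν : Measure S}
    (φ : BoundaryDensity ν) : Prop where
  mem_Icc : ∀ R : RegOpen S, ∀ᵐ x ∂ν.restrict (frontier R.set), φ R x ∈ Icc (0 : ℝ) 1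
  sum_eq_one : ∀ (N : ℕ) (P : Fin N → RegOpen S), (⊤ : RegOpen S).IsPartition P →
    ∀ᵐ x ∂ν.restrict (⋃ n, frontier (P n).set),
      ∑ n, (frontier (P n).set).indicator (φ (P n)) x = 1

/-- `μ[R] = ν(R) + ∫_{∂R} φ_R dν`. -/
def MassFormula {S : Type*} [TopologicalSpace S] [MeasurableSpace S] (μ : Credence S)
    {ν : Measure S} (φ : BoundaryDensity ν) (R : RegOpen S) : Prop :=
  ν R.set < ⊤ ∧ μ.toFun R = ν.real R.set + ∫ x in frontier R.set, φ R x ∂ν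

/-- `I_R[f] = ∫_R f dν + ∫_{∂R} f φ_R dν`, with both integrands integrable. -/
def IntegralFormula {S : Type*} [TopologicalSpace S] [MeasurableSpace S] (I : Integrator S)
    {ν : Measure S} (φ : BoundaryDensity ν) (R : RegOpen S) (f : S → ℝ) : Prop :=
  IntegrableOn f R.set ν ∧ IntegrableOn (fun x => f x * φ R x) (frontier R.set) ν ∧
    I.HasValue R f (∫ x in R.set, f x ∂ν + ∫ x in frontier R.set, f x * φ R x ∂ν)

end

noncomputable section

/-! ### Finite partitions of regular open sets -/

namespace RegOpen

variable {S : Type*} [TopologicalSpace S]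

/-! A credence supports Darboux integration. Cutting `S` along regularized sublevel sets of a
bounded continuous g gives a regular partition on whose cells g oscillates by at most ε
(`exists_partition_oscillation`), so some lower and upper sums over R differ by at most ε. The norm
of a monotone functional is its value at 1, so compatibility says I_R[1] = μ[R]. Monotonicity and
additivity then trap I_R[g] between the Darboux sums, which gives uniqueness; the Darboux integral
itself gives existence.

For the measures, the Riesz–Markov–Kakutani theorem is applied to every I_R, not only to I_S, and
yields finite regular measures ν_R (`Integrator.measure`). Uniqueness in that theorem turns
additivity of the integrator into ν_R = ∑ ν_{R_n} for partitions of R (`measure_eq_sum`), so ν_R ≤ ν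
:= ν_S. Cutoff functions show that ν_R lives on the closure of R; the same fact for ¬R forces ν_R =
ν on R. Only the part of ν_R on ∂R remains free, and φ_R is its Radon–Nikodym density there.
Equation (2) is ∫ f dν_R split along R and ∂R (`integral_measure_eq`), (1) is the case f = 1, and
the densities of a partition sum to 1 because its measures sum to ν. Conversely, (2) fixes the
integrals of f φ_R over ∂R for compactly supported f, hence φ_R (`density_ae_eq_of_integral_eq`). -/

protected theorem inf_of_le {Q R : RegOpen S} (h : Q ≤ R) : Q ⊓ R = Q := inf_eq_left.2 h

protected theorem inf_comm (Q R : RegOpen S) : Q ⊓ R = R ⊓ Q := _root_.inf_comm _ _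

theorem set_mono {Q R : RegOpen S} (h : Q ≤ R) : Q.set ⊆ R.set := h

/-- The regularization of a set. -/
def ofSet (A : Set S) : RegOpen S :=
  ((exists_set_eq_iff (interior (closure A))).2 (by
    refine subset_antisymm (interior_mono ?_) ?_
    · exact closure_minimal interior_subset isClosed_closure
    · exact interior_maximal subset_closure isOpen_interior)).choose

theorem set_ofSet (A : Set S) : (ofSet A).set = interior (closure A) :=
  Exists.choose_spec (p := fun R : RegOpen S => R.set = interior (closure A)) _

/-- Regularizing an open sublevel set keeps it inside the closed sublevel set, and its Boolean
complement still avoids the open one. So successive differences of the regularized sets trap g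
between consecutive levels. -/
theorem exists_partition_oscillation (g : S →ᵇ ℝ) {ε : ℝ} (hε : 0 < ε) :
    ∃ (N : ℕ) (P : Fin N → RegOpen S) (c : Fin N → ℝ), Pairwise (Function.onFun Disjoint P) ∧
      Finset.univ.sup P = ⊤ ∧ ∀ i, ∀ x ∈ (P i).set, c i ≤ g x ∧ g x ≤ c i + ε := by
  obtain ⟨M, hM⟩ : ∃ M : ℝ, ∀ x, |g x| ≤ M := ⟨‖g‖, fun x => g.norm_coe_le_norm x⟩
  obtain ⟨N, hN⟩ := exists_nat_gt (2 * M / ε)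
  rw [div_lt_iff₀ hε] at hN
  let V : Fin (N + 1) → RegOpen S := fun k => ofSet {x | g x < -M + k * ε}
  have hV : ∀ k, ∀ x ∈ (V k).set, g x ≤ -M + k * ε := by
    intro k x hx
    rw [set_ofSet] at hx
    exact closure_lt_subset_le g.continuous continuous_const (interior_subset hx)
  have hV' : ∀ k, ∀ x ∈ ((V k)ᶜ).set, -M + k * ε ≤ g x := by
    intro k x hx
    rw [set_compl] at hx
    by_contra! h
    refine interior_subset hx ?_
    rw [set_ofSet]
    exact interior_maximal subset_closure (isOpen_lt g.continuous continuous_const) h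
  -- Cell k lies between levels k - 1 and k, hence the extra `- ε`. By the choice of `N` the last
  -- level exceeds the bound `M`, so the last set is everything.
  refine ⟨N + 1, disjointed V, fun k => -M + k * ε - ε, disjoint_disjointed V, ?_, ?_⟩
  · rw [Fintype.sup_disjointed]
    refine top_le_iff.1 (le_trans ?_ (Finset.le_sup (Finset.mem_univ (Fin.last N))))
    have : V (Fin.last N) = ⊤ := by
      apply set_injective
      have : {x | g x < -M + (Fin.last N : ℕ) * ε} = univ := by
        refine eq_univ_of_forall fun x => ?_
        have := (abs_le.1 (hM x)).2
        simp only [mem_ofPred_eq, Fin.val_last]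
        linarith
      simp only [V]
      rw [set_ofSet, this, closure_univ, interior_univ, set_top]
    exact this.ge
  · intro k x hx
    refine ⟨?_, ?_⟩
    · obtain ⟨k, hk⟩ := k
      cases k with
      | zero =>
        have := (abs_le.1 (hM x)).1
        simp only [Nat.cast_zero, zero_mul]
        linarith
      | succ j =>
        have hle : disjointed V ⟨j + 1, hk⟩ ≤ (V ⟨j, by omega⟩)ᶜ := by
          rw [disjointed_apply]
          refine le_trans (_root_.sdiff_eq (α := RegOpen S)).le
            (inf_le_right.trans (compl_le_compl (Finset.le_sup ?_)))
          simp
        have := hV' _ x (set_mono hle hx)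
        simp only [Nat.cast_add, Nat.cast_one]
        simp only at this
        linarith
    · have := hV k x (set_mono (disjointed_le V k) hx)
      linarith

theorem sup_inf_partition {ι : Type*} [Fintype ι] (Q : RegOpen S) (P : ι → RegOpen S) :
    (Finset.univ.sup fun i => Q ⊓ P i) = Q ⊓ Finset.univ.sup P :=
  (Finset.sup_inf_distrib_left _ _ _).symm

theorem pairwise_disjoint_inf {ι : Type*} {P : ι → RegOpen S}
    (hP : Pairwise (Function.onFun Disjoint P)) (Q : RegOpen S) :
    Pairwise (Function.onFun Disjoint fun i => Q ⊓ P i) := fun _ _ h =>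
  (hP h).mono inf_le_right inf_le_right

theorem isPartition_compl (R : RegOpen S) : (⊤ : RegOpen S).IsPartition ![R, Rᶜ] := by
  refine ⟨?_, ?_⟩
  · intro i j hij
    fin_cases i <;> fin_cases j <;>
      first
        | exact absurd rfl hij
        | exact disjoint_compl_right
        | exact disjoint_compl_left
  · simp [Fin.univ_succ]

end RegOpen

/-! ### Integration against a credence -/

namespace Credence

variable {S : Type*} [TopologicalSpace S] (μ : Credence S)

theorem nonneg (R : RegOpen S) : 0 ≤ μ.toFun R := (μ.mem_Icc R).1

theorem map_bot : μ.toFun ⊥ = 0 := by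
  simpa using μ.additive 0 (fun _ => ⊥) (fun i => i.elim0)

theorem map_of_set_eq_empty {R : RegOpen S} (h : R.set = ∅) : μ.toFun R = 0 := by
  rw [RegOpen.set_injective (h.trans RegOpen.set_bot.symm), map_bot]

theorem sum_map {ι : Type*} [Fintype ι] {P : ι → RegOpen S}
    (hP : Pairwise (Function.onFun Disjoint P)) :
    ∑ i, μ.toFun (P i) = μ.toFun (Finset.univ.sup P) := by
  let e := Fintype.equivFin ι
  have h := μ.additive _ (P ∘ e.symm) (fun i j hij => hP (e.symm.injective.ne hij))
  have hs : Finset.univ.sup (P ∘ e.symm) = Finset.univ.sup P := by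
    refine le_antisymm (Finset.sup_le fun i _ => ?_) (Finset.sup_le fun i _ => ?_)
    · exact Finset.le_sup (f := P) (Finset.mem_univ (e.symm i))
    · simpa using Finset.le_sup (f := P ∘ e.symm) (Finset.mem_univ (e i))
  rw [← hs, h]
  exact (e.symm.sum_comp fun i => μ.toFun (P i)).symm

theorem sum_map_inf {ι : Type*} [Fintype ι] {P : ι → RegOpen S}
    (hP : Pairwise (Function.onFun Disjoint P)) (Q : RegOpen S) :
    ∑ i, μ.toFun (Q ⊓ P i) = μ.toFun (Q ⊓ Finset.univ.sup P) := by
  rw [μ.sum_map (RegOpen.pairwise_disjoint_inf hP Q), RegOpen.sup_inf_partition]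

/-- `s` is a lower Darboux sum of `f` over `R`. -/
def IsLowerSum (R : RegOpen S) (f : S → ℝ) (s : ℝ) : Prop :=
  ∃ (N : ℕ) (P : Fin N → RegOpen S) (c : Fin N → ℝ), R.IsPartition P ∧
    (∀ i, ∀ x ∈ (P i).set, c i ≤ f x) ∧ ∑ i, c i * μ.toFun (P i) = s

/-- `s` is an upper Darboux sum of `f` over `R`. -/
def IsUpperSum (R : RegOpen S) (f : S → ℝ) (s : ℝ) : Prop :=
  μ.IsLowerSum R (-f) (-s)

variable {μ} {R : RegOpen S} {f g : S → ℝ} {s t : ℝ}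

/-- General index types are needed because a common refinement is indexed by a product. -/
theorem IsLowerSum.of_fintype {ι : Type*} [Fintype ι] (P : ι → RegOpen S) (c : ι → ℝ)
    (hP : Pairwise (Function.onFun Disjoint P)) (hR : Finset.univ.sup P = R)
    (hc : ∀ i, ∀ x ∈ (P i).set, c i ≤ f x) : μ.IsLowerSum R f (∑ i, c i * μ.toFun (P i)) := by
  let e := Fintype.equivFin ι
  refine ⟨_, P ∘ e.symm, c ∘ e.symm, ⟨fun i j hij => hP (e.symm.injective.ne hij), ?_⟩,
    fun i => hc _, e.symm.sum_comp fun i => c i * μ.toFun (P i)⟩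
  rw [← hR]
  refine le_antisymm (Finset.sup_le fun i _ => ?_) (Finset.sup_le fun i _ => ?_)
  · exact Finset.le_sup (f := P) (Finset.mem_univ (e.symm i))
  · simpa using Finset.le_sup (f := P ∘ e.symm) (Finset.mem_univ (e i))

theorem IsLowerSum.const {c : ℝ} (h : ∀ x ∈ R.set, c ≤ f x) :
    μ.IsLowerSum R f (c * μ.toFun R) := by
  simpa using IsLowerSum.of_fintype (μ := μ) (fun _ : Unit => R) (fun _ => c)
    (fun i j h => absurd (Subsingleton.elim i j) h) (by simp) (fun _ => h)

theorem IsLowerSum.mono (h : μ.IsLowerSum R f s) (hfg : ∀ x ∈ R.set, f x ≤ g x) :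
    μ.IsLowerSum R g s := by
  obtain ⟨N, P, c, hP, hc, hs⟩ := h
  refine ⟨N, P, c, hP, fun i x hx => (hc i x hx).trans (hfg x ?_), hs⟩
  exact RegOpen.set_mono (hP.2 ▸ Finset.le_sup (Finset.mem_univ i)) hx

theorem IsLowerSum.add (hf : μ.IsLowerSum R f s) (hg : μ.IsLowerSum R g t) :
    μ.IsLowerSum R (f + g) (s + t) := by
  obtain ⟨N, P, c, ⟨hP, hPR⟩, hc, rfl⟩ := hf
  obtain ⟨M, Q, d, ⟨hQ, hQR⟩, hd, rfl⟩ := hg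
  have hPle : ∀ i, P i ≤ R := fun i => hPR ▸ Finset.le_sup (Finset.mem_univ i)
  have hQle : ∀ i, Q i ≤ R := fun i => hQR ▸ Finset.le_sup (Finset.mem_univ i)
  -- Both sums are rewritten over the common refinement; summing out either index returns the
  -- original masses.
  have key := IsLowerSum.of_fintype (μ := μ) (R := R) (f := f + g)
    (fun p : Fin N × Fin M => P p.1 ⊓ Q p.2) (fun p => c p.1 + d p.2) ?_ ?_ ?_
  · convert key
    rw [Fintype.sum_prod_type]
    simp only [add_mul, Finset.sum_add_distrib, ← Finset.mul_sum]
    congr 1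
    · refine Finset.sum_congr rfl fun i _ => ?_
      rw [μ.sum_map_inf hQ, hQR, RegOpen.inf_of_le (hPle i)]
    · rw [Finset.sum_comm]
      refine Finset.sum_congr rfl fun j _ => ?_
      rw [← Finset.mul_sum]
      simp only [RegOpen.inf_comm _ (Q j)]
      rw [μ.sum_map_inf hP, hPR, RegOpen.inf_of_le (hQle j)]
  · rintro ⟨i, j⟩ ⟨i', j'⟩ h
    by_cases hi : i = i'
    · have hj : j ≠ j' := by rintro rfl; exact h (by rw [hi])
      exact (hQ hj).mono inf_le_right inf_le_right
    · exact (hP hi).mono inf_le_left inf_le_left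
  · refine le_antisymm (Finset.sup_le fun p _ => inf_le_left.trans (hPle _)) ?_
    rw [← hPR]
    refine Finset.sup_le fun i _ => ?_
    rw [← RegOpen.inf_of_le (hPle i), ← hQR, ← RegOpen.sup_inf_partition]
    exact Finset.sup_le fun j _ =>
      Finset.le_sup (f := fun p : Fin N × Fin M => P p.1 ⊓ Q p.2) (Finset.mem_univ (i, j))
  · rintro ⟨i, j⟩ x ⟨hx, hx'⟩
    exact add_le_add (hc i x hx) (hd j x hx')

theorem IsLowerSum.smul (hf : μ.IsLowerSum R f s) {a : ℝ} (ha : 0 ≤ a) :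
    μ.IsLowerSum R (a • f) (a * s) := by
  obtain ⟨N, P, c, hP, hc, rfl⟩ := hf
  refine ⟨N, P, fun i => a * c i, hP,
    fun i x hx => mul_le_mul_of_nonneg_left (hc i x hx) ha, ?_⟩
  simp only [Finset.mul_sum, mul_assoc]

/-- A nonempty cell forces its constant to be nonpositive; an empty cell may carry any constant but
has mass zero. -/
theorem IsLowerSum.nonpos (h : μ.IsLowerSum R 0 s) : s ≤ 0 := by
  obtain ⟨N, P, c, hP, hc, rfl⟩ := h
  refine Finset.sum_nonpos fun i _ => ?_
  rcases (P i).set.eq_empty_or_nonempty with h | ⟨x, hx⟩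
  · rw [μ.map_of_set_eq_empty h, mul_zero]
  · exact mul_nonpos_of_nonpos_of_nonneg (hc i x hx) (μ.nonneg _)

/-- A lower sum for `f` and one for `-f` add up to a lower sum for 0. -/
theorem IsLowerSum.le (hs : μ.IsLowerSum R f s) (ht : μ.IsUpperSum R f t) : s ≤ t := by
  have h := hs.add ht
  rw [add_neg_cancel] at h
  linarith [h.nonpos]

variable (μ) in
-- Darboux integrability: with oscillation ε on each cell, the gap is ε times a mass of at most 1.
theorem exists_lower_upper (R : RegOpen S) (g : S →ᵇ ℝ) {ε : ℝ} (hε : 0 < ε) :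
    ∃ s t, μ.IsLowerSum R g s ∧ μ.IsUpperSum R g t ∧ t ≤ s + ε := by
  obtain ⟨N, P, c, hP, hPR, hc⟩ := RegOpen.exists_partition_oscillation g hε
  have h1 : R.IsPartition fun i => R ⊓ P i :=
    ⟨RegOpen.pairwise_disjoint_inf hP R, by rw [RegOpen.sup_inf_partition, hPR, RegOpen.inf_of_le le_top]⟩
  refine ⟨_, ∑ i, (c i + ε) * μ.toFun (R ⊓ P i), ⟨N, fun i => R ⊓ P i, c, h1,
    fun i x hx => (hc i x hx.2).1, rfl⟩, ⟨N, fun i => R ⊓ P i, fun i => -(c i + ε), h1,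
    fun i x hx => neg_le_neg (hc i x hx.2).2, by
    simp only [neg_mul, Finset.sum_neg_distrib]⟩, ?_⟩
  simp only [add_mul, Finset.sum_add_distrib, ← Finset.mul_sum]
  rw [μ.sum_map_inf hP]
  nlinarith [(μ.mem_Icc (R ⊓ Finset.univ.sup P)).2]

variable (μ) in
/-- The lower Darboux integral of `f` over `R`. -/
def integral (R : RegOpen S) (f : S → ℝ) : ℝ := sSup {s | μ.IsLowerSum R f s}

theorem IsLowerSum.le_integral {g : S →ᵇ ℝ} (h : μ.IsLowerSum R g s) : s ≤ μ.integral R g := by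
  obtain ⟨_, t, -, ht, -⟩ := μ.exists_lower_upper R g one_pos
  exact le_csSup ⟨t, fun _ hs => hs.le ht⟩ h

theorem IsUpperSum.integral_le {g : S →ᵇ ℝ} (h : μ.IsUpperSum R g t) : μ.integral R g ≤ t := by
  obtain ⟨s, _, hs, -, -⟩ := μ.exists_lower_upper R g one_pos
  exact csSup_le ⟨s, hs⟩ fun _ hs => hs.le h

theorem integral_eq_of_approx {g : S →ᵇ ℝ} {v : ℝ}
    (h : ∀ ε > 0, ∃ s t, μ.IsLowerSum R g s ∧ μ.IsUpperSum R g t ∧ t ≤ s + ε ∧ s ≤ v ∧ v ≤ t) :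
    μ.integral R g = v := by
  refine le_antisymm (le_of_forall_pos_le_add fun ε hε => ?_)
    (le_of_forall_pos_le_add fun ε hε => ?_)
  all_goals
    obtain ⟨s, t, hs, ht, h1, h2, h3⟩ := h ε hε
    have := hs.le_integral
    have := ht.integral_le
    linarith

theorem integral_eq_of_forall {g : S →ᵇ ℝ} {v : ℝ} (h₁ : ∀ s, μ.IsLowerSum R g s → s ≤ v)
    (h₂ : ∀ t, μ.IsUpperSum R g t → v ≤ t) : μ.integral R g = v := by
  refine integral_eq_of_approx fun ε hε => ?_
  obtain ⟨s, t, hs, ht, h⟩ := μ.exists_lower_upper R g hε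
  exact ⟨s, t, hs, ht, h, h₁ s hs, h₂ t ht⟩

theorem integral_add (g h : S →ᵇ ℝ) :
    μ.integral R (g + h : S →ᵇ ℝ) = μ.integral R g + μ.integral R h := by
  refine integral_eq_of_approx fun ε hε => ?_
  obtain ⟨s, t, hs, ht, h1⟩ := μ.exists_lower_upper R g (half_pos hε)
  obtain ⟨s', t', hs', ht', h1'⟩ := μ.exists_lower_upper R h (half_pos hε)
  refine ⟨s + s', t + t', hs.add hs', ?_, by linarith,
    add_le_add hs.le_integral hs'.le_integral, add_le_add ht.integral_le ht'.integral_le⟩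
  have := IsLowerSum.add ht ht'
  rw [← neg_add, ← neg_add] at this
  exact this

theorem integral_neg (g : S →ᵇ ℝ) : μ.integral R (-g : S →ᵇ ℝ) = -μ.integral R g := by
  refine integral_eq_of_approx fun ε hε => ?_
  obtain ⟨s, t, hs, ht, h1⟩ := μ.exists_lower_upper R g hε
  refine ⟨-t, -s, ht, ?_, by linarith, neg_le_neg ht.integral_le, neg_le_neg hs.le_integral⟩
  rw [IsUpperSum, neg_neg, BoundedContinuousFunction.coe_neg, neg_neg]
  exact hs

theorem integral_smul_of_nonneg {a : ℝ} (ha : 0 ≤ a) (g : S →ᵇ ℝ) :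
    μ.integral R (a • g : S →ᵇ ℝ) = a * μ.integral R g := by
  refine integral_eq_of_approx fun ε hε => ?_
  -- Dividing by `a + 1` rather than `a` covers `a = 0`.
  have ha' : 0 < a + 1 := by linarith
  obtain ⟨s, t, hs, ht, h1⟩ := μ.exists_lower_upper R g (div_pos hε ha')
  refine ⟨a * s, a * t, hs.smul ha, ?_, ?_, mul_le_mul_of_nonneg_left hs.le_integral ha,
    mul_le_mul_of_nonneg_left ht.integral_le ha⟩
  · have := IsLowerSum.smul ht ha
    rw [smul_neg, mul_neg] at this
    exact this
  · have h2 : a * t ≤ a * (s + ε / (a + 1)) := mul_le_mul_of_nonneg_left h1 ha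
    have h3 : a * (ε / (a + 1)) ≤ ε := by
      rw [mul_div_assoc', div_le_iff₀ ha']
      nlinarith
    linarith

theorem integral_smul (a : ℝ) (g : S →ᵇ ℝ) :
    μ.integral R (a • g : S →ᵇ ℝ) = a * μ.integral R g := by
  rcases le_total 0 a with ha | ha
  · exact integral_smul_of_nonneg ha g
  · have h := integral_smul_of_nonneg (μ := μ) (R := R) (neg_nonneg.2 ha) g
    have e : -a • g = -(a • g) := by ext; simp
    rw [e, integral_neg] at h
    linarith

theorem integral_mono {g h : S →ᵇ ℝ} (hgh : ∀ x ∈ R.set, g x ≤ h x) :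
    μ.integral R g ≤ μ.integral R h := by
  obtain ⟨s, _, hs, -, -⟩ := μ.exists_lower_upper R g one_pos
  exact csSup_le ⟨s, hs⟩ fun _ hs => (hs.mono hgh).le_integral

theorem integral_congr {g h : S →ᵇ ℝ} (hgh : ∀ x ∈ R.set, g x = h x) :
    μ.integral R g = μ.integral R h :=
  le_antisymm (integral_mono fun x hx => (hgh x hx).le) (integral_mono fun x hx => (hgh x hx).ge)

theorem integral_le_mul {g : S →ᵇ ℝ} {c : ℝ} (h : ∀ x ∈ R.set, g x ≤ c) :
    μ.integral R g ≤ c * μ.toFun R := by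
  apply IsUpperSum.integral_le
  rw [IsUpperSum, ← neg_mul]
  exact IsLowerSum.const fun x hx => neg_le_neg (h x hx)

theorem mul_le_integral {g : S →ᵇ ℝ} {c : ℝ} (h : ∀ x ∈ R.set, c ≤ g x) :
    c * μ.toFun R ≤ μ.integral R g :=
  (IsLowerSum.const h).le_integral

/-- Intersecting the cells of the lower sum with each `P n` splits it into lower sums over the `P
n`. Applied to `-g`, this also gives the reverse inequality in `integral_eq_sum`. -/
theorem IsLowerSum.le_sum_integral {N : ℕ} {P : Fin N → RegOpen S} (hP : R.IsPartition P)
    {g : S →ᵇ ℝ} (h : μ.IsLowerSum R g s) : s ≤ ∑ n, μ.integral (P n) g := by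
  obtain ⟨M, Q, c, ⟨hQ, hQR⟩, hc, rfl⟩ := h
  have hPle : ∀ i, P i ≤ R := fun i => hP.2 ▸ Finset.le_sup (Finset.mem_univ i)
  have hQle : ∀ i, Q i ≤ R := fun i => hQR ▸ Finset.le_sup (Finset.mem_univ i)
  calc ∑ k, c k * μ.toFun (Q k) = ∑ k, ∑ n, c k * μ.toFun (Q k ⊓ P n) := by
        refine Finset.sum_congr rfl fun k _ => ?_
        rw [← Finset.mul_sum, μ.sum_map_inf hP.1, hP.2, RegOpen.inf_of_le (hQle k)]
    _ = ∑ n, ∑ k, c k * μ.toFun (P n ⊓ Q k) := by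
        rw [Finset.sum_comm]
        exact Finset.sum_congr rfl fun n _ => Finset.sum_congr rfl fun k _ => by
          rw [RegOpen.inf_comm]
    _ ≤ _ := Finset.sum_le_sum fun n _ => by
        refine IsLowerSum.le_integral ⟨M, fun k => P n ⊓ Q k, c,
          ⟨RegOpen.pairwise_disjoint_inf hQ _, ?_⟩, fun k x hx => hc k x hx.2, rfl⟩
        rw [RegOpen.sup_inf_partition, hQR, RegOpen.inf_of_le (hPle n)]

theorem integral_eq_sum {N : ℕ} {P : Fin N → RegOpen S} (hP : R.IsPartition P) (g : S →ᵇ ℝ) :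
    μ.integral R g = ∑ n, μ.integral (P n) g := by
  refine integral_eq_of_forall (fun s hs => hs.le_sum_integral hP) fun t ht => ?_
  have h := IsLowerSum.le_sum_integral hP (g := -g) ht
  simp only [integral_neg, Finset.sum_neg_distrib] at h
  linarith

variable (μ) in
/-- The integrator given by Darboux integration against `μ`. -/
def integrator : Integrator S where
  toFun R :=
    -- The chosen extension to `S` need not depend linearly on `h`; this is harmless because the
    -- integral sees only values on `R`.
    { toFun := fun h => μ.integral R h.2.choose
      map_add' := fun h k => by
        rw [← integral_add]
        refine integral_congr fun x hx => ?_
        have e := fun h : restrictedBCF R => DFunLike.congr_fun h.2.choose_spec ⟨x, hx⟩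
        exact (e (h + k)).trans (congrArg₂ (· + ·) (e h) (e k)).symm
      map_smul' := fun a h => by
        rw [RingHom.id_apply, smul_eq_mul, ← integral_smul]
        refine integral_congr fun x hx => ?_
        have e := fun h : restrictedBCF R => DFunLike.congr_fun h.2.choose_spec ⟨x, hx⟩
        exact (e (a • h)).trans (congrArg (a • ·) (e h)).symm }
  bounded R := by
    refine ⟨μ.toFun R, fun h => ?_⟩
    have e : ∀ x ∈ R.set, |h.2.choose x| ≤ ‖h.1‖ := fun x hx =>
      (congrArg abs (DFunLike.congr_fun h.2.choose_spec ⟨x, hx⟩)).trans_le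
        (h.1.norm_coe_le_norm ⟨x, hx⟩)
    rw [mul_comm, abs_le]
    refine ⟨?_, integral_le_mul fun x hx => (abs_le.1 (e x hx)).2⟩
    rw [← neg_mul]
    exact mul_le_integral fun x hx => (abs_le.1 (e x hx)).1
  monotone R h k hk := by
    refine integral_mono fun x hx => ?_
    have e := fun h : restrictedBCF R => DFunLike.congr_fun h.2.choose_spec ⟨x, hx⟩
    exact (e h).trans_le ((hk ⟨x, hx⟩).trans_eq (e k).symm)
  additive R N P hP g := by
    have e : ∀ Q : RegOpen S, μ.integral Q (restrictBCF Q g).2.choose = μ.integral Q g := fun Q =>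
      integral_congr fun x hx => DFunLike.congr_fun (restrictBCF Q g).2.choose_spec ⟨x, hx⟩
    change μ.integral R (restrictBCF R g).2.choose =
      ∑ n, μ.integral (P n) (restrictBCF (P n) g).2.choose
    simp only [e]
    exact integral_eq_sum hP g

end Credence

/-! ### Existence and uniqueness of the compatible integrator -/

namespace Integrator

variable {S : Type*} [TopologicalSpace S]

/-- The value of the integrator at the restriction of `g` to `R`. -/
def val (I : Integrator S) (R : RegOpen S) (g : S →ᵇ ℝ) : ℝ := I.toFun R (restrictBCF R g)

theorem val_add (I : Integrator S) (R : RegOpen S) (g h : S →ᵇ ℝ) :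
    I.val R (g + h) = I.val R g + I.val R h :=
  map_add (I.toFun R) (restrictBCF R g) (restrictBCF R h)

theorem val_smul (I : Integrator S) (R : RegOpen S) (a : ℝ) (g : S →ᵇ ℝ) :
    I.val R (a • g) = a * I.val R g :=
  map_smul (I.toFun R) a (restrictBCF R g)

theorem val_neg (I : Integrator S) (R : RegOpen S) (g : S →ᵇ ℝ) :
    I.val R (-g) = -I.val R g :=
  map_neg (I.toFun R) (restrictBCF R g)

theorem val_sub (I : Integrator S) (R : RegOpen S) (g h : S →ᵇ ℝ) :
    I.val R (g - h) = I.val R g - I.val R h :=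
  map_sub (I.toFun R) (restrictBCF R g) (restrictBCF R h)

theorem val_zero (I : Integrator S) (R : RegOpen S) : I.val R 0 = 0 :=
  map_zero (I.toFun R)

theorem val_mono (I : Integrator S) {R : RegOpen S} {g h : S →ᵇ ℝ}
    (hgh : ∀ x ∈ R.set, g x ≤ h x) : I.val R g ≤ I.val R h :=
  I.monotone R _ _ fun x => hgh x x.2

theorem val_congr (I : Integrator S) {R : RegOpen S} {g h : S →ᵇ ℝ}
    (hgh : ∀ x ∈ R.set, g x = h x) : I.val R g = I.val R h :=
  le_antisymm (I.val_mono fun x hx => (hgh x hx).le) (I.val_mono fun x hx => (hgh x hx).ge)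

theorem val_one_nonneg (I : Integrator S) (R : RegOpen S) : 0 ≤ I.val R 1 := I.val_zero R ▸ I.val_mono fun _ _ => zero_le_one

theorem abs_val_le (I : Integrator S) (R : RegOpen S) {g : S →ᵇ ℝ} {c : ℝ} (h : ∀ x ∈ R.set, |g x| ≤ c) :
    |I.val R g| ≤ c * I.val R 1 := by
  rw [abs_le, ← val_smul, ← val_neg]
  refine ⟨I.val_mono fun x hx => ?_, I.val_mono fun x hx => ?_⟩
  · simpa using (abs_le.1 (h x hx)).1
  · simpa using (abs_le.1 (h x hx)).2

theorem val_eq_sum (I : Integrator S) {R : RegOpen S} {N : ℕ} {P : Fin N → RegOpen S}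
    (hP : R.IsPartition P) (g : S →ᵇ ℝ) : I.val R g = ∑ n, I.val (P n) g :=
  I.additive R N P hP g

theorem hasValue_iff {I : Integrator S} {R : RegOpen S} {f : S → ℝ} {v : ℝ} :
    I.HasValue R f v ↔ ∃ g : S →ᵇ ℝ, EqOn g f R.set ∧ I.val R g = v := by
  constructor
  · rintro ⟨⟨_, g, rfl⟩, h, hv⟩
    exact ⟨g, fun x hx => h ⟨x, hx⟩, hv⟩
  · rintro ⟨g, h, hv⟩
    exact ⟨restrictBCF R g, fun x => h x.2, hv⟩

theorem ext_val {I J : Integrator S} (h : ∀ R g, I.val R g = J.val R g) : I = J := by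
  have : I.toFun = J.toFun := by
    funext R
    ext ⟨_, g, rfl⟩
    exact h R g
  cases I
  cases J
  congr

variable {I : Integrator S} {μ : Credence S}

variable (I) in
-- By monotonicity the constant 1 attains the operator norm, which reduces compatibility to I_R[1] =
-- μ[R].
theorem isLUB_val_one (R : RegOpen S) :
    IsLUB ((fun f : restrictedBCF R => |I.toFun R f|) '' {f | ‖f.1‖ ≤ 1}) (I.val R 1) := by
  refine ⟨?_, fun b hb => ?_⟩
  · rintro _ ⟨⟨_, g, rfl⟩, hg, rfl⟩
    rw [← one_mul (I.val R 1)]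
    exact I.abs_val_le R fun x hx => ((g.domRestrict R.set).norm_coe_le_norm ⟨x, hx⟩).trans hg
  · refine hb ⟨restrictBCF R 1, ?_, abs_of_nonneg (I.val_one_nonneg R)⟩
    exact (BoundedContinuousFunction.norm_le zero_le_one).2 fun x => by
      change ‖(1 : ℝ)‖ ≤ 1
      simp

theorem IsCompatible.val_one (hI : I.IsCompatible μ) (R : RegOpen S) :
    I.val R 1 = μ.toFun R :=
  (I.isLUB_val_one R).unique (hI R)

theorem IsCompatible.of_val_one (h : ∀ R, I.val R 1 = μ.toFun R) : I.IsCompatible μ := fun R =>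
  h R ▸ I.isLUB_val_one R

theorem IsCompatible.mul_le_val (hI : I.IsCompatible μ) {R : RegOpen S} {g : S →ᵇ ℝ} {c : ℝ}
    (h : ∀ x ∈ R.set, c ≤ g x) : c * μ.toFun R ≤ I.val R g := by
  rw [← hI.val_one, ← val_smul]
  exact I.val_mono fun x hx => by simpa using h x hx

theorem IsCompatible.lowerSum_le (hI : I.IsCompatible μ) {R : RegOpen S} {g : S →ᵇ ℝ} {s : ℝ}
    (h : μ.IsLowerSum R g s) : s ≤ I.val R g := by
  obtain ⟨N, P, c, hP, hc, rfl⟩ := h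
  rw [I.val_eq_sum hP]
  exact Finset.sum_le_sum fun i _ => hI.mul_le_val (hc i)

theorem IsCompatible.val_eq_integral (hI : I.IsCompatible μ) (R : RegOpen S) (g : S →ᵇ ℝ) :
    I.val R g = μ.integral R g := by
  refine (Credence.integral_eq_of_forall (fun s hs => hI.lowerSum_le hs) fun t ht => ?_).symm
  have := hI.lowerSum_le (g := -g) ht
  rw [val_neg] at this
  linarith

theorem existsUnique_isCompatible (μ : Credence S) : ∃! I : Integrator S, I.IsCompatible μ := by
  refine ⟨μ.integrator, IsCompatible.of_val_one fun R => ?_, fun J hJ => ?_⟩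
  · have e : μ.integrator.val R 1 = μ.integral R (1 : S →ᵇ ℝ) :=
      Credence.integral_congr fun x hx =>
        DFunLike.congr_fun (restrictBCF R (1 : S →ᵇ ℝ)).2.choose_spec ⟨x, hx⟩
    rw [e]
    refine le_antisymm ?_ ?_
    · simpa using Credence.integral_le_mul (μ := μ) (R := R) (g := 1) (c := 1) fun _ _ => le_rfl
    · simpa using Credence.mul_le_integral (μ := μ) (R := R) (g := 1) (c := 1) fun _ _ => le_rfl
  · refine ext_val fun R g => ?_
    rw [hJ.val_eq_integral]
    exact Credence.integral_congr fun x hx =>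
      (DFunLike.congr_fun (restrictBCF R g).2.choose_spec ⟨x, hx⟩).symm

end Integrator

/-! ### Regularity of finite measures and densities -/

open CompactlySupported

theorem measure_le_ofReal_integral {S : Type*} [MeasurableSpace S] {ν : Measure S} {K : Set S}
    (hK : MeasurableSet K) {χ : S → ℝ} (hχ : Integrable χ ν) (h0 : ∀ x, 0 ≤ χ x)
    (h1 : ∀ x ∈ K, χ x = 1) : ν K ≤ ENNReal.ofReal (∫ x, χ x ∂ν) := by
  rw [ofReal_integral_eq_lintegral_ofReal hχ (Eventually.of_forall h0),
    ← lintegral_indicator_one hK]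
  refine lintegral_mono fun x => ?_
  by_cases hx : x ∈ K
  · simp [hx, h1 x hx]
  · simp [hx]

section Measure

variable {S : Type*} [TopologicalSpace S] [T2Space S] [MeasurableSpace S] [BorelSpace S]
  {ν : Measure S}

/-- A compact subset that misses little `ν`-mass misses even less `ρ`-mass. -/
theorem innerRegular_of_le [ν.InnerRegularCompactLTTop] [IsFiniteMeasure ν] {ρ : Measure S}
    (h : ρ ≤ ν) : ρ.InnerRegular := by
  refine ⟨fun A hA r hr => ?_⟩
  obtain ⟨K, hKA, hK, hlt⟩ :=
    hA.exists_isCompact_sdiff_lt (μ := ν) (measure_ne_top ν A) (tsub_pos_of_lt hr).ne'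
  refine ⟨K, hKA, hK, ?_⟩
  by_contra! hcon
  have h1 : ρ A ≤ ρ K + ρ (A \ K) := by
    refine (measure_mono ?_).trans (measure_union_le _ _)
    rw [union_sdiff_self]
    exact subset_union_right
  have h2 : ρ K + ρ (A \ K) < r + (ρ A - r) :=
    ENNReal.add_lt_add_of_le_of_lt (hcon.trans_lt (hr.trans_le le_top)).ne hcon ((h _).trans_lt hlt)
  rw [add_tsub_cancel_of_le hr.le] at h2
  exact (h1.trans_lt h2).false

/-- Densities in [0,1] define measures dominated by `ν`, hence inner regular and determined by their
integrals of compactly supported functions. Equal measures have a.e. equal densities. -/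
theorem density_ae_eq_of_integral_eq [LocallyCompactSpace S] [ν.InnerRegularCompactLTTop]
    [IsFiniteMeasure ν] {a b : S → ℝ} (ha : AEStronglyMeasurable a ν)
    (hb : AEStronglyMeasurable b ν) (ha' : ∀ᵐ x ∂ν, a x ∈ Icc (0 : ℝ) 1)
    (hb' : ∀ᵐ x ∂ν, b x ∈ Icc (0 : ℝ) 1)
    (h : ∀ f : C_c(S, ℝ), ∫ x, f x * a x ∂ν = ∫ x, f x * b x ∂ν) : a =ᵐ[ν] b := by
  have key : ∀ {c : S → ℝ}, AEStronglyMeasurable c ν → (∀ᵐ x ∂ν, c x ∈ Icc (0 : ℝ) 1) →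
      ν.withDensity (fun x => ENNReal.ofReal (c x)) ≤ ν ∧ ∀ f : C_c(S, ℝ),
        ∫ x, f x ∂(ν.withDensity fun x => ENNReal.ofReal (c x)) = ∫ x, f x * c x ∂ν := by
    intro c hc hc'
    refine ⟨?_, fun f => ?_⟩
    · calc ν.withDensity (fun x => ENNReal.ofReal (c x)) ≤ ν.withDensity 1 := by
            refine withDensity_mono ?_
            filter_upwards [hc'] with x hx
            exact ENNReal.ofReal_le_one.2 hx.2
        _ = ν := withDensity_one
    · rw [integral_withDensity_eq_integral_toReal_smul₀ hc.aemeasurable.ennreal_ofReal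
        (Eventually.of_forall fun x => ENNReal.ofReal_lt_top)]
      refine integral_congr_ae ?_
      filter_upwards [hc'] with x hx
      rw [ENNReal.toReal_ofReal hx.1, smul_eq_mul, mul_comm]
  obtain ⟨ha1, ha2⟩ := key ha ha'
  obtain ⟨hb1, hb2⟩ := key hb hb'
  have := innerRegular_of_le ha1
  have := innerRegular_of_le hb1
  have := isFiniteMeasure_of_le _ ha1
  have := isFiniteMeasure_of_le _ hb1
  have e := Measure.ext_of_integral_eq_on_compactlySupported fun f =>
    (ha2 f).trans ((h f).trans (hb2 f).symm)
  have e' := (withDensity_eq_iff_of_sigmaFinite ha.aemeasurable.ennreal_ofReal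
    hb.aemeasurable.ennreal_ofReal).1 e
  filter_upwards [e', ha', hb'] with x hx hxa hxb
  rw [← ENNReal.toReal_ofReal hxa.1, hx, ENNReal.toReal_ofReal hxb.1]

end Measure

/-! ### The representing measures of an integrator -/

section Cutoff

variable {S : Type*} [TopologicalSpace S] [T2Space S] [LocallyCompactSpace S]

/-- Multiply `f` by a Urysohn cutoff. The second bound makes the error small wherever `f` is small.
-/
theorem exists_compactlySupported_eqOn (f : C(S, ℝ)) {K : Set S} (hK : IsCompact K) :
    ∃ h : C_c(S, ℝ), EqOn h f K ∧ ∀ x, |h x - f x| ≤ |f x| := by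
  obtain ⟨χ, h1, hc, -, h01⟩ :=
    exists_continuousMap_one_of_isCompact_subset_isOpen hK isOpen_univ (subset_univ K)
  refine ⟨⟨χ * f, HasCompactSupport.mul_right (f := χ) hc⟩, fun x hx => ?_, fun x => ?_⟩
  · change χ x * f x = f x
    rw [h1 hx, Pi.one_apply, one_mul]
  · change |χ x * f x - f x| ≤ |f x|
    have : χ x * f x - f x = (χ x - 1) * f x := by ring
    rw [this, abs_mul]
    refine mul_le_of_le_one_left (abs_nonneg _) (abs_le.2 ⟨?_, ?_⟩) <;>
      linarith [(h01 x).1, (h01 x).2]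

end Cutoff

namespace Integrator

section Basic

variable {S : Type*} [TopologicalSpace S]

theorem HasValue.unique {I : Integrator S} {R : RegOpen S} {f : S → ℝ} {v w : ℝ}
    (hv : I.HasValue R f v) (hw : I.HasValue R f w) : v = w := by
  rw [hasValue_iff] at hv hw
  obtain ⟨g, hg, rfl⟩ := hv
  obtain ⟨h, hh, rfl⟩ := hw
  exact I.val_congr fun x hx => (hg hx).trans (hh hx).symm

/-- The positive linear functional `f ↦ I_R[f]` on the compactly supported functions. -/
def functional (I : Integrator S) (R : RegOpen S) : C_c(S, ℝ) →ₚ[ℝ] ℝ :=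
  PositiveLinearMap.mk₀
    { toFun := fun f => I.val R f.toBoundedContinuousFunction
      map_add' := fun f g =>
        I.val_add R f.toBoundedContinuousFunction g.toBoundedContinuousFunction
      map_smul' := fun a f => I.val_smul R a f.toBoundedContinuousFunction }
    fun _ hf => (I.val_zero R).symm.trans_le (I.val_mono fun x _ => hf x)

end Basic

/-- `ν` represents `I_R` on the compactly supported functions. -/
def Represents {S : Type*} [TopologicalSpace S] [MeasurableSpace S] (I : Integrator S) (R : RegOpen S) (ν : Measure S) : Prop :=
  ∀ f : C_c(S, ℝ), Integrable f ν ∧ ∫ x, f x ∂ν = I.val R f.toBoundedContinuousFunction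

theorem represents_of_rieszProperty {S : Type*} [TopologicalSpace S] [MeasurableSpace S]
    {I : Integrator S} {ν : Measure S} {F : Set C(S, ℝ)} (hF : vanishingAtInfinity S ⊆ F)
    (h : I.RieszProperty ν F) : I.Represents ⊤ ν := by
  intro f
  obtain ⟨hi, hv⟩ := h f.toContinuousMap (hF f.hasCompactSupport.is_zero_at_infty)
  exact ⟨hi, hv.unique (hasValue_iff.2 ⟨f.toBoundedContinuousFunction, fun _ _ => rfl, rfl⟩)⟩

variable {S : Type*} [TopologicalSpace S] [T2Space S] [LocallyCompactSpace S]
  [MeasurableSpace S] [BorelSpace S]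

/-- The measure that represents `I_R` on the compactly supported functions. -/
def measure (I : Integrator S) (R : RegOpen S) : Measure S :=
  RealRMK.rieszMeasure (I.functional R)

instance (I : Integrator S) (R : RegOpen S) : (I.measure R).Regular :=
  RealRMK.regular_rieszMeasure _

variable {I : Integrator S} {R : RegOpen S} {ν : Measure S}

variable (I R) in
theorem represents_measure : I.Represents R (I.measure R) := fun f =>
  ⟨f.continuous.integrable_of_hasCompactSupport f.hasCompactSupport,
    RealRMK.integral_rieszMeasure (I.functional R) f⟩

/-- Compact sets are tested against cutoffs below 1. Finiteness of `ν` is a consequence, which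
matters for candidate measures not yet known to be finite. -/
theorem Represents.measure_univ_le (h : I.Represents R ν)
    (hν : ν.InnerRegularWRT IsCompact IsOpen) : ν univ ≤ ENNReal.ofReal (I.val R 1) := by
  by_contra! hlt
  obtain ⟨K, -, hK, hK1⟩ := hν isOpen_univ _ hlt
  obtain ⟨χ, h1, hc, -, h01⟩ :=
    exists_continuousMap_one_of_isCompact_subset_isOpen hK isOpen_univ (subset_univ K)
  obtain ⟨hi, hv⟩ := h ⟨χ, hc⟩
  refine hK1.not_ge ((measure_le_ofReal_integral hK.measurableSet hi (fun x => (h01 x).1)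
    fun x hx => h1 hx).trans (ENNReal.ofReal_le_ofReal ?_))
  rw [hv]
  exact I.val_mono fun x _ => (h01 x).2

instance (I : Integrator S) (R : RegOpen S) : IsFiniteMeasure (I.measure R) :=
  ⟨((I.represents_measure R).measure_univ_le Measure.Regular.innerRegular).trans_lt
    ENNReal.ofReal_lt_top⟩

theorem Represents.eq_measure (h : I.Represents R ν) [ν.Regular] : ν = I.measure R :=
  Measure.ext_of_integral_eq_on_compactlySupported fun f =>
    (h f).2.trans (I.represents_measure R f).2.symm

variable (I R) in
-- Both sides are continuous in the uniform norm, in which cutoffs approximate `g`.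
theorem integral_measure_of_tendsto {g : S →ᵇ ℝ} (hg : Tendsto g (cocompact S) (𝓝 0)) :
    ∫ x, g x ∂I.measure R = I.val R g := by
  refine eq_of_forall_dist_le fun ε hε => ?_
  set m := (I.measure R).real univ + I.val R 1 with hm
  have hm0 : 0 ≤ m := add_nonneg measureReal_nonneg (I.val_one_nonneg R)
  set δ := ε / (m + 1) with hδ
  have hδ0 : 0 < δ := by positivity
  obtain ⟨K, hK, hKg⟩ := mem_cocompact.1 (hg (Metric.ball_mem_nhds 0 hδ0))
  obtain ⟨h, hh1, hh2⟩ := exists_compactlySupported_eqOn g.toContinuousMap hK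
  have hgh : ∀ x, |(g - h.toBoundedContinuousFunction) x| ≤ δ := by
    intro x
    change |g x - h x| ≤ δ
    by_cases hx : x ∈ K
    · have : h x = g x := hh1 hx
      rw [this, sub_self, abs_zero]
      exact hδ0.le
    · have : |g x| < δ := by simpa using hKg hx
      rw [abs_sub_comm]
      exact (hh2 x).trans this.le
  have e1 : dist (∫ x, g x ∂I.measure R) (∫ x, h x ∂I.measure R)
      ≤ δ * (I.measure R).real univ := by
    rw [dist_eq_norm, ← integral_sub (g.integrable _) (I.represents_measure R h).1]
    exact norm_integral_le_of_norm_le_const (Eventually.of_forall hgh)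
  have e2 : dist (I.val R h.toBoundedContinuousFunction) (I.val R g) ≤ δ * I.val R 1 := by
    rw [dist_comm, Real.dist_eq, ← val_sub]
    exact I.abs_val_le R fun x _ => hgh x
  rw [(I.represents_measure R h).2] at e1
  calc _ ≤ _ := dist_triangle _ _ _
    _ ≤ δ * m := by rw [hm, mul_add]; exact add_le_add e1 e2
    _ ≤ ε := by
      rw [hδ, div_mul_eq_mul_div, div_le_iff₀ (by positivity)]
      nlinarith

variable (I R) in
-- The sum on the right is regular and represents I_R too, so uniqueness of the Riesz measure
-- applies.
theorem measure_eq_sum {N : ℕ} {P : Fin N → RegOpen S} (hP : R.IsPartition P) :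
    I.measure R = ∑ n, I.measure (P n) := by
  refine (Represents.eq_measure fun f => ⟨?_, ?_⟩).symm
  · exact integrable_finsetSum_measure.2 fun n _ => (I.represents_measure (P n) f).1
  · rw [integral_finsetSum_measure fun n _ => (I.represents_measure (P n) f).1,
      I.val_eq_sum hP]
    exact Finset.sum_congr rfl fun n _ => (I.represents_measure (P n) f).2

variable (I R) in
theorem measure_top_eq_add : I.measure ⊤ = I.measure R + I.measure Rᶜ := by
  rw [I.measure_eq_sum ⊤ R.isPartition_compl]
  simp [Fin.sum_univ_two]

variable (I R) in
theorem measure_le_top : I.measure R ≤ I.measure ⊤ := by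
  rw [I.measure_top_eq_add R]
  exact Measure.le_add_right le_rfl

variable (I R) in
-- A cutoff supported off the closure of `R` vanishes on `R`, so I_R kills it.
theorem measure_compl_closure : I.measure R (closure R.set)ᶜ = 0 := by
  by_contra hne
  obtain ⟨K, hKU, hK, hK0⟩ := Measure.Regular.innerRegular (μ := I.measure R)
    isClosed_closure.isOpen_compl 0 (pos_iff_ne_zero.2 hne)
  obtain ⟨χ, h1, hc, hs, h01⟩ := exists_continuousMap_one_of_isCompact_subset_isOpen hK
    isClosed_closure.isOpen_compl hKU
  obtain ⟨hi, hv⟩ := I.represents_measure R ⟨χ, hc⟩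
  refine hK0.not_ge ((measure_le_ofReal_integral hK.measurableSet hi (fun x => (h01 x).1)
    fun x hx => h1 hx).trans (ENNReal.ofReal_eq_zero.2 ?_).le)
  rw [hv, ← I.val_zero R]
  refine I.val_mono fun x hx => le_of_eq ?_
  by_contra h
  exact hs (subset_tsupport χ h) (subset_closure hx)

variable (I R) in
-- The measure of `Rᶜ` lives on the closure of `Rᶜ`, which misses the open set `R`; so on `R` only
-- the first summand of the total measure survives.
theorem restrict_measure_eq :
    (I.measure R).restrict R.set = (I.measure ⊤).restrict R.set := by
  have h : (I.measure Rᶜ).restrict R.set = 0 := by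
    rw [Measure.restrict_eq_zero]
    refine measure_mono_null ?_ (I.measure_compl_closure Rᶜ)
    rw [subset_compl_comm]
    refine closure_minimal ?_ R.isOpen_set.isClosed_compl
    rw [RegOpen.set_compl]
    exact interior_subset
  rw [I.measure_top_eq_add R, Measure.restrict_add, h, add_zero]

variable (I R) in
theorem restrict_union_frontier :
    (I.measure R).restrict (R.set ∪ frontier R.set) = I.measure R := by
  rw [← closure_eq_self_union_frontier]
  exact Measure.restrict_eq_self_of_ae_mem (I.measure_compl_closure R)

/-! ### The liminal density structure of an integrator -/

/-- The Radon–Nikodym densities of the measures representing `I_R` on the boundaries. -/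
def density (I : Integrator S) : BoundaryDensity (I.measure ⊤) := fun R =>
  (Measure.integrable_toReal_rnDeriv (μ := I.measure R)
    (ν := I.measure ⊤)).restrict (s := frontier R.set) |>.toL1 _

variable (I R) in
theorem density_ae_eq : I.density R =ᵐ[(I.measure ⊤).restrict (frontier R.set)]
    fun x => ((I.measure R).rnDeriv (I.measure ⊤) x).toReal :=
  Integrable.coeFn_toL1 _

variable (I R) in
theorem measure_absolutelyContinuous : I.measure R ≪ I.measure ⊤ :=
  (I.measure_le_top R).absolutelyContinuous

theorem integrableOn_mul_density {f : S → ℝ} (hf : Integrable f (I.measure R)) :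
    IntegrableOn (fun x => f x * I.density R x) (frontier R.set) (I.measure ⊤) := by
  have h := ((integrable_toReal_rnDeriv_mul_iff (I.measure_absolutelyContinuous R)).2
    hf).restrict (s := frontier R.set)
  refine h.congr ?_
  filter_upwards [I.density_ae_eq R] with x hx
  rw [hx, mul_comm]

theorem setIntegral_mul_density (f : S → ℝ) :
    ∫ x in frontier R.set, f x * I.density R x ∂I.measure ⊤ =
      ∫ x in frontier R.set, f x ∂I.measure R := by
  rw [← setIntegral_toReal_rnDeriv_mul (I.measure_absolutelyContinuous R)
    isClosed_frontier.measurableSet]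
  refine integral_congr_ae ?_
  filter_upwards [I.density_ae_eq R] with x hx
  rw [hx, mul_comm]

theorem integral_measure_eq {f : S → ℝ} (hf : Integrable f (I.measure R)) :
    ∫ x, f x ∂I.measure R = ∫ x in R.set, f x ∂I.measure ⊤ +
      ∫ x in frontier R.set, f x * I.density R x ∂I.measure ⊤ := by
  have hdisj : Disjoint R.set (frontier R.set) := by
    rw [R.isOpen_set.frontier_eq]
    exact disjoint_sdiff_right
  rw [setIntegral_mul_density, ← I.restrict_measure_eq R, ← setIntegral_union
    hdisj
    isClosed_frontier.measurableSet hf.integrableOn hf.integrableOn, I.restrict_union_frontier R]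

variable (I) in
theorem isLiminalDensity_density : IsLiminalDensity I.density where
  mem_Icc R := by
    filter_upwards [I.density_ae_eq R,
      ae_restrict_of_ae (Measure.rnDeriv_le_one_of_le (I.measure_le_top R))] with x hx hx1
    rw [hx]
    exact ⟨ENNReal.toReal_nonneg, ENNReal.toReal_le_of_le_ofReal zero_le_one (by simpa using hx1)⟩
  sum_eq_one N P hP := by
    set T := ⋃ n, frontier (P n).set with hT
    have hsub : ∀ n, frontier (P n).set ⊆ T := fun n => subset_iUnion (fun n => frontier (P n).set) n
    have hF : ∀ n, MeasurableSet (frontier (P n).set) := fun n => isClosed_frontier.measurableSet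
    have hTm : MeasurableSet T := MeasurableSet.iUnion hF
    have hrr : ∀ n, ((I.measure ⊤).restrict T).restrict (frontier (P n).set) =
        (I.measure ⊤).restrict (frontier (P n).set) := fun n =>
      Measure.restrict_restrict_of_subset (hsub n)
    have hint : ∀ n, Integrable ((frontier (P n).set).indicator (I.density (P n)))
        ((I.measure ⊤).restrict T) := by
      intro n
      rw [integrable_indicator_iff (hF n), IntegrableOn, hrr]
      exact L1.integrable_coeFn _
    -- An open cell cannot meet the boundary of another cell, since it would then meet that cell
    -- itself.
    have hdisj : ∀ n, ∀ x ∈ T, x ∈ closure (P n).set → x ∈ frontier (P n).set := by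
      intro n x hxT hx
      refine ⟨hx, fun hxn => ?_⟩
      rw [(P n).isOpen_set.interior_eq] at hxn
      obtain ⟨m, hm⟩ := mem_iUnion.1 hxT
      obtain ⟨y, hyn, hym⟩ := mem_closure_iff.1 hm.1 _ (P n).isOpen_set hxn
      by_cases hnm : n = m
      · subst hnm
        rw [(P n).isOpen_set.frontier_eq] at hm
        exact hm.2 hxn
      · exact disjoint_left.1 ((RegOpen.disjoint_iff_set _ _).1 (hP.1 hnm)) hyn hym
    -- It suffices to compare integrals over sets `A`: each term is the mass that the measure of `P
    -- n` gives to `A ∩ T`, and these masses add up to the total measure.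
    refine Integrable.ae_eq_of_forall_setIntegral_eq _ (fun _ => (1 : ℝ))
      (integrable_finsetSum _ fun n _ => hint n) (integrable_const _) fun A hA _ => ?_
    rw [integral_finsetSum _ fun n _ => (hint n).integrableOn]
    have hterm : ∀ n, ∫ x in A, (frontier (P n).set).indicator (I.density (P n)) x
        ∂(I.measure ⊤).restrict T = (I.measure (P n)).real (A ∩ T) := by
      intro n
      rw [setIntegral_indicator (hF n), Measure.restrict_restrict (hA.inter (hF n)),
        inter_eq_left.2 (inter_subset_right.trans (hsub n)),
        integral_congr_ae (ae_restrict_of_ae_restrict_of_subset inter_subset_right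
          (I.density_ae_eq (P n))),
        Measure.setIntegral_toReal_rnDeriv (I.measure_absolutelyContinuous (P n))]
      refine measureReal_congr ?_
      filter_upwards [show ∀ᵐ x ∂I.measure (P n), x ∈ closure (P n).set from
        I.measure_compl_closure (P n)] with x hx
      exact propext ⟨fun h => ⟨h.1, hsub n h.2⟩, fun h => ⟨h.1, hdisj n x h.2 hx⟩⟩
    simp only [hterm, setIntegral_const, smul_eq_mul, mul_one]
    rw [measureReal_restrict_apply hA, I.measure_eq_sum ⊤ hP, measureReal_def,
      Measure.finsetSum_apply, ENNReal.toReal_sum fun n _ => measure_ne_top _ _]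
    rfl

/-- Values off the closure of `R` are irrelevant, so `f` may be unbounded there. This serves both
functions vanishing at infinity and cutoffs over a compact closure. -/
theorem integralFormula_of_eqOn {g : S →ᵇ ℝ} {f : S → ℝ} (hgf : EqOn g f (closure R.set))
    (hg : ∫ x, g x ∂I.measure R = I.val R g) : IntegralFormula I I.density R f := by
  have hae : g =ᵐ[I.measure R] f := by
    filter_upwards [show ∀ᵐ x ∂I.measure R, x ∈ closure R.set from I.measure_compl_closure R]
      with x hx using hgf hx
  have hf : Integrable f (I.measure R) := (g.integrable _).congr hae
  refine ⟨?_, integrableOn_mul_density hf, ?_⟩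
  · rw [IntegrableOn, ← I.restrict_measure_eq R]
    exact hf.restrict
  · rw [← integral_measure_eq hf, ← integral_congr_ae hae, hg, hasValue_iff]
    exact ⟨g, hgf.mono subset_closure, rfl⟩

theorem integralFormula_of_mem_vanishingAtInfinity {f : C(S, ℝ)}
    (hf : f ∈ vanishingAtInfinity S) : IntegralFormula I I.density R f :=
  integralFormula_of_eqOn (g := (⟨f, hf⟩ : ZeroAtInftyContinuousMap S ℝ).toBCF)
    (fun _ _ => rfl) (I.integral_measure_of_tendsto R hf)

theorem integralFormula_of_mem_compactClosure (f : C(S, ℝ))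
    (hR : R ∈ RegOpen.compactClosure S) : IntegralFormula I I.density R f := by
  obtain ⟨h, hh, -⟩ := exists_compactlySupported_eqOn f hR
  exact integralFormula_of_eqOn (g := h.toBoundedContinuousFunction) hh
    (I.represents_measure R h).2

theorem IsCompatible.massFormula_of_mem_compactClosure {μ : Credence S} (hI : I.IsCompatible μ)
    (hR : R ∈ RegOpen.compactClosure S) : MassFormula μ I.density R := by
  refine ⟨measure_lt_top _ _, ?_⟩
  obtain ⟨-, -, h⟩ := integralFormula_of_mem_compactClosure (I := I) 1 hR
  have h1 : I.HasValue R (1 : C(S, ℝ)) (μ.toFun R) :=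
    hasValue_iff.2 ⟨1, fun _ _ => rfl, hI.val_one R⟩
  rw [h1.unique h]
  simp

variable (I) in
theorem eq_density {ψ : BoundaryDensity (I.measure ⊤)} (hψ : IsLiminalDensity ψ)
    (h : ∀ f ∈ vanishingAtInfinity S, ∀ R : RegOpen S, IntegralFormula I ψ R f) :
    ψ = I.density := by
  funext R
  refine Lp.ext (density_ae_eq_of_integral_eq (Lp.aestronglyMeasurable _)
    (Lp.aestronglyMeasurable _) (hψ.mem_Icc R) (I.isLiminalDensity_density.mem_Icc R)
    fun f => ?_)
  have hf : f.toContinuousMap ∈ vanishingAtInfinity S :=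
    f.hasCompactSupport.is_zero_at_infty
  have e := (h _ hf R).2.2.unique
    (integralFormula_of_mem_vanishingAtInfinity (I := I) (R := R) hf).2.2
  -- The integrals over `R` agree, leaving equality of the boundary terms.
  exact add_left_cancel e

/-! ### Riesz measures -/

variable (I) in
theorem rieszProperty_measure : I.RieszProperty (I.measure ⊤) (vanishingAtInfinity S) := by
  intro f hf
  let g : S →ᵇ ℝ := (⟨f, hf⟩ : ZeroAtInftyContinuousMap S ℝ).toBCF
  exact ⟨g.integrable _, hasValue_iff.2
    ⟨g, fun _ _ => rfl, (I.integral_measure_of_tendsto ⊤ (g := g) hf).symm⟩⟩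

theorem eq_measure_of_isRadonMeasure (hν : IsRadonMeasure ν) {F : Set C(S, ℝ)}
    (hF : vanishingAtInfinity S ⊆ F) (h : I.RieszProperty ν F) : ν = I.measure ⊤ := by
  have hr := represents_of_rieszProperty hF h
  have hin : ν.InnerRegularWRT IsCompact IsOpen := fun U hU => hν.1 hU.measurableSet
  have : IsFiniteMeasure ν := ⟨(hr.measure_univ_le hin).trans_lt ENNReal.ofReal_lt_top⟩
  have : ν.InnerRegular := ⟨hν.1⟩
  exact hr.eq_measure

variable (I) in
theorem isRadonMeasure_measure (R : RegOpen S) : IsRadonMeasure (I.measure R) :=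
  ⟨Measure.InnerRegular.innerRegular, inferInstance⟩

end Integrator

end

theorem mainTheorem3 {S : Type*} [TopologicalSpace S] [LocallyCompactSpace S] [T4Space S]
    [MeasurableSpace S] [BorelSpace S] (μ : Credence S) :
    (∃! I : Integrator S, I.IsCompatible μ) ∧
    ∀ I : Integrator S, I.IsCompatible μ →
      ((∃! ν : Measure S, IsRadonMeasure ν ∧ I.RieszProperty ν (vanishingAtInfinity S)) ∧
        ∀ ν : Measure S, IsRadonMeasure ν → I.RieszProperty ν (vanishingAtInfinity S) →
          ∃ φ : BoundaryDensity ν,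
            (IsLiminalDensity φ ∧
              (∀ R ∈ RegOpen.compactClosure S, MassFormula μ φ R) ∧
              (∀ f ∈ vanishingAtInfinity S, ∀ R : RegOpen S, IntegralFormula I φ R f)) ∧
            (∀ ψ : BoundaryDensity ν,
              (IsLiminalDensity ψ ∧
                (∀ R ∈ RegOpen.compactClosure S, MassFormula μ ψ R) ∧
                (∀ f ∈ vanishingAtInfinity S, ∀ R : RegOpen S, IntegralFormula I ψ R f)) →
              ψ = φ) ∧
            (∀ f : C(S, ℝ), ∀ R ∈ RegOpen.compactClosure S, IntegralFormula I φ R f)) ∧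
      (CompactSpace S →
        (∃! ν : Measure S,
          IsProbabilityMeasure ν ∧ IsNormalMeasure ν ∧ I.RieszProperty ν Set.univ) ∧
        ∀ ν : Measure S, IsProbabilityMeasure ν → IsNormalMeasure ν →
          I.RieszProperty ν Set.univ →
          ∃! φ : BoundaryDensity ν, IsLiminalDensity φ ∧
            (∀ R : RegOpen S, MassFormula μ φ R) ∧
            (∀ (f : C(S, ℝ)) (R : RegOpen S), IntegralFormula I φ R f)) := by
  refine ⟨Integrator.existsUnique_isCompatible μ, fun I hI => ⟨⟨⟨I.measure ⊤,
    ⟨I.isRadonMeasure_measure ⊤, I.rieszProperty_measure⟩, fun ν hν =>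
      Integrator.eq_measure_of_isRadonMeasure hν.1 subset_rfl hν.2⟩, fun ν hν hνI => ?_⟩,
      fun hS => ?_⟩⟩
  -- The type of a boundary density depends on the measure, so `ν` is replaced by the Riesz measure
  -- before a density is supplied.
  · obtain rfl := Integrator.eq_measure_of_isRadonMeasure hν subset_rfl hνI
    exact ⟨I.density, ⟨I.isLiminalDensity_density,
      fun R hR => hI.massFormula_of_mem_compactClosure hR,
      fun f hf R => Integrator.integralFormula_of_mem_vanishingAtInfinity hf⟩,
      fun ψ hψ => I.eq_density hψ.1 hψ.2.2,
      fun f R hR => Integrator.integralFormula_of_mem_compactClosure f hR⟩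
  · have huniv : vanishingAtInfinity S = Set.univ :=
      eq_univ_of_forall fun f => by simp [vanishingAtInfinity]
    have hcc : ∀ R : RegOpen S, R ∈ RegOpen.compactClosure S := fun R =>
      isClosed_closure.isCompact
    -- In a compact Hausdorff space closed and compact sets coincide.
    have hrad : ∀ ν : Measure S, IsNormalMeasure ν ↔ IsRadonMeasure ν := fun ν => by
      have : (IsClosed : Set S → Prop) = IsCompact :=
        funext fun K => propext ⟨fun h => h.isCompact, fun h => h.isClosed⟩
      rw [IsNormalMeasure, IsRadonMeasure, this]
    have heq : ∀ ν : Measure S, IsNormalMeasure ν → I.RieszProperty ν Set.univ →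
        ν = I.measure ⊤ := fun ν hν h =>
      Integrator.eq_measure_of_isRadonMeasure ((hrad ν).1 hν) (subset_univ _) h
    have hriesz : I.RieszProperty (I.measure ⊤) Set.univ := huniv ▸ I.rieszProperty_measure
    refine ⟨⟨I.measure ⊤, ⟨?_, (hrad _).2 (I.isRadonMeasure_measure ⊤), hriesz⟩,
      fun ν hν => heq ν hν.2.1 hν.2.2⟩, fun ν _ hν hνI => ?_⟩
    -- The total mass is the integral of 1, namely I_S[1] = μ[S] = 1.
    · have h1 : I.HasValue ⊤ (1 : C(S, ℝ)) 1 :=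
        Integrator.hasValue_iff.2 ⟨1, fun _ _ => rfl, (hI.val_one ⊤).trans μ.map_top⟩
      have e := h1.unique (hriesz 1 (mem_univ _)).2
      refine ⟨?_⟩
      have e' : (I.measure ⊤).real univ = 1 := by simpa using e.symm
      rw [measureReal_def, ENNReal.toReal_eq_one_iff] at e'
      exact e'
    · obtain rfl := heq ν hν hνI
      exact ⟨I.density, ⟨I.isLiminalDensity_density,
        fun R => hI.massFormula_of_mem_compactClosure (hcc R),
        fun f R => Integrator.integralFormula_of_mem_compactClosure f (hcc R)⟩,
        fun ψ hψ => I.eq_density hψ.1 fun f _ R => hψ.2.2 f R⟩
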